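/- A standard triangular array is a family $\{\xi_{n,k}\}_{n\ge 1,\,1\le k\le n}$ of real square integrable random variables such that for every $n\ge 1$ the variables $\xi_{n,1},\dots,\xi_{n,n}$ are defined on a common probability space (which may depend on $n$) and are independent, $\mathbb E[\xi_{n,k}]=0$ for all $k$, and $\sum_{k=1}^n \mathbb E[\xi_{n,k}^2]=1$. It satisfies Feller's negligibility condition if $\max_{1\le k\le n}\mathbb E[\xi_{n,k}^2]\to 0$ as $n\to\infty$. For $\gamma>0$ put $$\widetilde{\mathrm{Lin}}_\gamma(\{\xi_{n,k}\})=\limsup_{n\to\infty}\sum_{k=1}^n\mathbb E\left[\xi_{n,k}^2\left(1-e^{-\gamma\xi_{n,k}^2}\right)\right],$$ and let $K(\eta,\eta')=\sup_{x\in\mathbb R}\left|\mathbb P[\eta\le x]-\mathbb P[\eta'\le x]\right|$ denote the Kolmogorov distance between real random variables $\eta,\eta'$. **Corollary 3.5.** For every $\gamma>0$ there is a constant $C_\gamma>0$, depending only on $\gamma$, such that for every standard triangular array $\{\xi_{n,k}\}$ satisfying Feller's negligibility condition and every standard normally distributed random variable $\xi$, $$\widetilde{\mathrm{Lin}}_\gamma(\{\xi_{n,k}\})\le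 C_\gamma\,\limsup_{n\to\infty}K\left(\xi,\sum_{k=1}^n\xi_{n,k}\right).$$ -/

import Mathlib

open MeasureTheory ProbabilityTheory Filter Topology

noncomputable section

/-- The Kolmogorov distance `K(η, η') = sup_x |P[η ≤ x] - P'[η' ≤ x]|` between two real random
variables, possibly living on different probability spaces. -/
def kolmogorovDist {Ω Ω' : Type*} [MeasurableSpace Ω] [MeasurableSpace Ω']
    (P : Measure Ω) (P' : Measure Ω') (η : Ω → ℝ) (η' : Ω' → ℝ) : ℝ :=
  ⨆ x : ℝ, |P.real {ω | η ω ≤ x} - P'.real {ω | η' ω ≤ x}|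

/-- A standard triangular array: for every `n ≥ 1`, the `n`-th row consists of `n` independent,
centered, square integrable real random variables (on a probability space that may depend on `n`)
whose variances add up to one. The empty row `n = 0` is unconstrained. -/
structure IsStandardTriangularArray {Ω : ℕ → Type*} [∀ n, MeasurableSpace (Ω n)]
    (P : ∀ n, Measure (Ω n)) (ξ : ∀ n, Fin n → Ω n → ℝ) : Prop where
  measurable : ∀ n, 1 ≤ n → ∀ k, Measurable (ξ n k)
  memLp : ∀ n, 1 ≤ n → ∀ k, MemLp (ξ n k) 2 (P n)
  indep : ∀ n, 1 ≤ n → iIndepFun (ξ n) (P n)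
  integral_eq_zero : ∀ n, 1 ≤ n → ∀ k, ∫ ω, ξ n k ω ∂(P n) = 0
  sum_variance : ∀ n, 1 ≤ n → ∑ k, ∫ ω, (ξ n k ω) ^ 2 ∂(P n) = 1

/-- Feller's negligibility condition `max_{1 ≤ k ≤ n} E[ξ_{n,k}²] → 0`. -/
def FellerNegligible {Ω : ℕ → Type*} [∀ n, MeasurableSpace (Ω n)]
    (P : ∀ n, Measure (Ω n)) (ξ : ∀ n, Fin n → Ω n → ℝ) : Prop :=
  Tendsto (fun n => ⨆ k : Fin n, ∫ ω, (ξ n k ω) ^ 2 ∂(P n)) atTop (𝓝 0)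

/-- The relaxed Lindeberg index with respect to `φ`,
`limsup_n ∑_{k ≤ n} E[ξ_{n,k}² φ(|ξ_{n,k}|)]`. -/
def relaxedLindebergIndex {Ω : ℕ → Type*} [∀ n, MeasurableSpace (Ω n)]
    (P : ∀ n, Measure (Ω n)) (ξ : ∀ n, Fin n → Ω n → ℝ) (φ : ℝ → ℝ) : ℝ :=
  limsup (fun n => ∑ k, ∫ ω, (ξ n k ω) ^ 2 * φ |ξ n k ω| ∂(P n)) atTop

/-- The function `φ_γ(x) = 1 - exp(-γ x²)`. -/
def lindebergPhi (γ : ℝ) (x : ℝ) : ℝ := 1 - Real.exp (-γ * x ^ 2)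

end

/-! This is Stein's method run backwards, with `f(w) = w exp(-w²/2)`. Let `W` be a row sum, `Z`
standard normal, `δ` their Kolmogorov distance and `M` the largest variance in the row. Since `w
f(w)` has finite variation, `E[W f(W)]` is within `O(δ)` of `E[Z f(Z)] = 1/(2√2)`.

On the other hand `E[W f(W)] = ∑ E[ξ_k f(Y_k + ξ_k)]` with `Y_k = W - ξ_k` independent of `ξ_k`.
Because `ξ_k` is centered, only `E[f(Y_k + x)] - E[f(Y_k)]` at `x = ξ_k` matters. Up to an error
`O(δ + √M) |x|` it equals its Gaussian value `x exp(-x²/4) / (2√2)`, so the sum is close to `∑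
E[ξ_k² exp(-ξ_k²/4)] / (2√2)`.

Subtracting, with variances summing to one, gives `∑ E[ξ_k² (1 - exp(-ξ_k²/4))] = O(δ + √M)`: this
is `sum_integral_sq_mul_one_sub_exp_le`. Feller's condition removes `√M` in the limit, and
`one_sub_exp_neg_mul_le` passes from `1/4` to any `γ`. -/

/-! ### Kolmogorov distance against functions of finite variation -/

/-- If the distribution functions of `μ` and `ν` differ by at most `δ`, then the integrals of a
`C¹` function `h` vanishing at `-∞` differ by at most `δ` times the total variation of `h`. -/
theorem abs_integral_sub_integral_le_mul_variation {μ ν : Measure ℝ} [IsProbabilityMeasure μ]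
    [IsProbabilityMeasure ν] {δ : ℝ}
    (hδ : ∀ x, |μ.real (Set.Iic x) - ν.real (Set.Iic x)| ≤ δ) {h h' : ℝ → ℝ}
    (hd : ∀ x, HasDerivAt h (h' x) x) (hi : Integrable h') (h0 : Tendsto h atBot (𝓝 0)) :
    |∫ w, h w ∂μ - ∫ w, h w ∂ν| ≤ δ * ∫ y, |h' y| := by
  -- Write `h(w)` as the integral of `h'` over `y < w` and apply Fubini; only the distribution
  -- function of `ρ` remains.
  have tail : ∀ (ρ : Measure ℝ) [IsProbabilityMeasure ρ],
      Integrable (fun y => (1 - ρ.real (Set.Iic y)) * h' y) ∧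
      ∫ w, h w ∂ρ = ∫ y, (1 - ρ.real (Set.Iic y)) * h' y := by
    intro ρ _
    have hS : MeasurableSet {p : ℝ × ℝ | p.2 < p.1} :=
      measurableSet_lt measurable_snd measurable_fst
    have hF : Integrable (Function.uncurry fun w y : ℝ => (Set.Iio w).indicator h' y)
        (ρ.prod volume) := by
      have : (Function.uncurry fun w y : ℝ => (Set.Iio w).indicator h' y)
          = {p : ℝ × ℝ | p.2 < p.1}.indicator (fun p => h' p.2) := by
        ext ⟨w, y⟩
        simp [Function.uncurry, Set.indicator_apply]
      rw [this]
      exact (hi.comp_snd ρ).indicator hS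
    have e1 : ∀ w, h w = ∫ y, (Set.Iio w).indicator h' y := by
      intro w
      rw [integral_indicator measurableSet_Iio, ← integral_Iic_eq_integral_Iio,
        integral_Iic_of_hasDerivAt_of_tendsto (hd w).continuousAt.continuousWithinAt
          (fun x _ => hd x) hi.integrableOn h0, sub_zero]
    have e2 : ∀ y, ∫ w, (Set.Iio w).indicator h' y ∂ρ = (1 - ρ.real (Set.Iic y)) * h' y := by
      intro y
      have : (fun w => (Set.Iio w).indicator h' y) = (Set.Ioi y).indicator fun _ => h' y := by
        ext w
        simp [Set.indicator_apply]
      rw [this, integral_indicator measurableSet_Ioi, setIntegral_const, smul_eq_mul,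
        ← Set.compl_Iic, probReal_compl_eq_one_sub measurableSet_Iic]
    refine ⟨?_, ?_⟩
    · simpa only [Function.uncurry, e2] using hF.integral_prod_right
    · simp_rw [e1]
      rw [integral_integral_swap hF]
      simp_rw [e2]
  obtain ⟨iμ, eμ⟩ := tail μ
  obtain ⟨iν, eν⟩ := tail ν
  rw [eμ, eν, ← integral_sub iμ iν, ← integral_const_mul]
  refine abs_integral_le_integral_abs.trans
    (integral_mono (iμ.sub iν).abs (hi.abs.const_mul δ) fun y => ?_)
  have : (1 - μ.real (Set.Iic y)) * h' y - (1 - ν.real (Set.Iic y)) * h' y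
      = -((μ.real (Set.Iic y) - ν.real (Set.Iic y)) * h' y) := by ring
  simp only [this, abs_neg, abs_mul]
  exact mul_le_mul_of_nonneg_right (hδ y) (abs_nonneg _)

/-! ### The Stein test function, its derivatives and bounds -/

/-- The function `exp(-w²/2)`. -/
noncomputable def expSq (w : ℝ) : ℝ := Real.exp (-w ^ 2 / 2)

/-- The test function `w exp(-w²/2)`. -/
noncomputable def testFn (w : ℝ) : ℝ := w * expSq w

/-- The derivative of `testFn`. -/
noncomputable def testFnDeriv (w : ℝ) : ℝ := (1 - w ^ 2) * expSq w

/-- The second derivative of `testFn`. -/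
noncomputable def testFnDeriv₂ (w : ℝ) : ℝ := (w ^ 3 - 3 * w) * expSq w

theorem hasDerivAt_expSq (w : ℝ) : HasDerivAt expSq (-testFn w) w := by
  have h : HasDerivAt (fun w : ℝ => -w ^ 2 / 2) (-w) w := by
    refine (((hasDerivAt_id w).pow 2).neg.div_const 2).congr_deriv ?_
    simp; ring
  exact h.exp.congr_deriv (by simp only [testFn, expSq]; ring)

theorem hasDerivAt_testFn (w : ℝ) : HasDerivAt testFn (testFnDeriv w) w :=
  ((hasDerivAt_id w).mul (hasDerivAt_expSq w)).congr_deriv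
    (by simp only [testFnDeriv, testFn, id]; ring)

theorem hasDerivAt_testFnDeriv (w : ℝ) : HasDerivAt testFnDeriv (testFnDeriv₂ w) w :=
  ((((hasDerivAt_id w).pow 2).const_sub 1).mul (hasDerivAt_expSq w)).congr_deriv
    (by simp only [testFnDeriv₂, testFn, id]; simp; ring)

theorem hasDerivAt_mul_testFn (w : ℝ) :
    HasDerivAt (fun w => w * testFn w) ((2 * w - w ^ 3) * expSq w) w :=
  ((hasDerivAt_id w).mul (hasDerivAt_testFn w)).congr_deriv
    (by simp only [testFnDeriv, testFn, id]; ring)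

theorem continuous_expSq : Continuous expSq := by unfold expSq; fun_prop

theorem continuous_testFn : Continuous testFn := continuous_id.mul continuous_expSq

theorem continuous_testFnDeriv : Continuous testFnDeriv := by
  have := continuous_expSq
  unfold testFnDeriv; fun_prop

theorem expSq_pos (w : ℝ) : 0 < expSq w := Real.exp_pos _

theorem quadratic_mul_expSq_le_one (w : ℝ) : (1 + w ^ 2 / 2 + w ^ 4 / 8) * expSq w ≤ 1 := by
  have h := Real.quadratic_le_exp_of_nonneg (x := w ^ 2 / 2) (by positivity)
  have h2 : Real.exp (w ^ 2 / 2) * expSq w = 1 := by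
    rw [expSq, ← Real.exp_add]; simp; ring
  calc (1 + w ^ 2 / 2 + w ^ 4 / 8) * expSq w
      ≤ Real.exp (w ^ 2 / 2) * expSq w :=
        mul_le_mul_of_nonneg_right (by linarith [h]) (expSq_pos w).le
    _ = 1 := h2

/-- A polynomial factor dominated by `c (1 + w²/2 + w⁴/8)` is tamed by `exp(-w²/2)`. -/
theorem abs_mul_expSq_le {a c w : ℝ} (h : |a| ≤ c * (1 + w ^ 2 / 2 + w ^ 4 / 8)) (hc : 0 ≤ c) :
    |a * expSq w| ≤ c := by
  rw [abs_mul, abs_of_pos (expSq_pos w)]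
  calc |a| * expSq w ≤ c * (1 + w ^ 2 / 2 + w ^ 4 / 8) * expSq w :=
        mul_le_mul_of_nonneg_right h (expSq_pos w).le
    _ = c * ((1 + w ^ 2 / 2 + w ^ 4 / 8) * expSq w) := by ring
    _ ≤ c := mul_le_of_le_one_right hc (quadratic_mul_expSq_le_one w)

theorem abs_expSq_le (w : ℝ) : |expSq w| ≤ 1 := by
  have := abs_mul_expSq_le (a := 1) (c := 1) (w := w) (by
    rw [abs_one]; nlinarith [sq_nonneg w, sq_nonneg (w ^ 2)])
    zero_le_one
  simpa using this

theorem abs_testFn_le (w : ℝ) : |testFn w| ≤ 4 :=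
  abs_mul_expSq_le (by
    rw [abs_le]
    constructor <;> nlinarith [sq_nonneg (w - 1), sq_nonneg (w + 1), sq_nonneg (w ^ 2)])
    (by norm_num)

theorem abs_testFnDeriv_le (w : ℝ) : |testFnDeriv w| ≤ 4 :=
  abs_mul_expSq_le (by
    rw [abs_le]; constructor <;> nlinarith [sq_nonneg w, sq_nonneg (w ^ 2)]) (by norm_num)

theorem abs_testFnDeriv₂_le (w : ℝ) : |testFnDeriv₂ w| ≤ 4 :=
  abs_mul_expSq_le (by
    rw [abs_le]
    constructor <;> nlinarith [sq_nonneg (w - 1), sq_nonneg (w + 1), sq_nonneg (w * (w - 1)),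
      sq_nonneg (w * (w + 1)), sq_nonneg w]) (by norm_num)

theorem integrable_pow_mul_expSq (n : ℕ) : Integrable fun w : ℝ => w ^ n * expSq w := by
  have h := integrable_rpow_mul_exp_neg_mul_sq (b := 1 / 2) (by norm_num) (s := n)
    (by have : (0 : ℝ) ≤ n := n.cast_nonneg
        linarith)
  refine h.congr (ae_of_all _ fun w => ?_)
  simp only [Real.rpow_natCast, expSq]
  congr 2; ring

theorem tendsto_pow_mul_expSq (n : ℕ) :
    Tendsto (fun w : ℝ => w ^ n * expSq w) (cocompact ℝ) (𝓝 0) := by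
  have h := tendsto_rpow_abs_mul_exp_neg_mul_sq_cocompact (a := 1 / 2) (by norm_num) n
  rw [tendsto_zero_iff_abs_tendsto_zero]
  refine h.congr fun w => ?_
  simp only [Real.rpow_natCast, expSq, Function.comp, abs_mul, abs_pow, Real.abs_exp]
  congr 2; ring

theorem tendsto_testFnDeriv : Tendsto testFnDeriv (cocompact ℝ) (𝓝 0) := by
  have h := (tendsto_pow_mul_expSq 0).sub (tendsto_pow_mul_expSq 2)
  rw [sub_zero] at h
  exact h.congr fun w => by simp only [testFnDeriv]; ring

theorem tendsto_mul_testFn : Tendsto (fun w => w * testFn w) (cocompact ℝ) (𝓝 0) :=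
  (tendsto_pow_mul_expSq 2).congr fun w => by simp only [testFn]; ring

theorem integrable_testFnDeriv₂ : Integrable testFnDeriv₂ :=
  ((integrable_pow_mul_expSq 3).sub ((integrable_pow_mul_expSq 1).const_mul 3)).congr
    (ae_of_all _ fun w => by simp only [Pi.sub_apply, testFnDeriv₂]; ring)

theorem integrable_deriv_mul_testFn : Integrable fun w : ℝ => (2 * w - w ^ 3) * expSq w :=
  (((integrable_pow_mul_expSq 1).const_mul 2).sub (integrable_pow_mul_expSq 3)).congr
    (ae_of_all _ fun w => by simp only [Pi.sub_apply]; ring)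

/-! ### Gaussian expectations of the shifted test function -/

/-- Differentiation of `y ↦ E[g(W + y)]` under the expectation for bounded `C¹` functions. -/
theorem hasDerivAt_integral_shift (μ : Measure ℝ) [IsFiniteMeasure μ] {g g' : ℝ → ℝ} {a b : ℝ}
    (hg : ∀ x, HasDerivAt g (g' x) x) (hc : Continuous g') (ha : ∀ x, |g x| ≤ a)
    (hb : ∀ x, |g' x| ≤ b) (y : ℝ) :
    HasDerivAt (fun y => ∫ w, g (w + y) ∂μ) (∫ w, g' (w + y) ∂μ) y := by
  have cg : Continuous g := continuous_iff_continuousAt.2 fun x => (hg x).continuousAt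
  refine (hasDerivAt_integral_of_dominated_loc_of_deriv_le (bound := fun _ => b)
    (F' := fun y w => g' (w + y)) univ_mem
    (Eventually.of_forall fun x => ?_) ?_ ?_ (ae_of_all _ fun w x _ => hb _)
    (integrable_const b) (ae_of_all _ fun w x _ => ?_)).2
  · exact (cg.comp (by fun_prop)).aestronglyMeasurable
  · exact Integrable.of_bound (cg.comp (by fun_prop)).aestronglyMeasurable a
      (ae_of_all _ fun w => ha _)
  · exact (hc.comp (by fun_prop)).aestronglyMeasurable
  · exact (hg (w + x)).comp_const_add w x

/-- Complete the square: `w²/2 + (w + y)²/2 = (w + y/2)² + y²/4`. -/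
theorem integral_expSq_gaussianReal (y : ℝ) :
    ∫ w, expSq (w + y) ∂(gaussianReal 0 1) = (√2)⁻¹ * Real.exp (-y ^ 2 / 4) := by
  rw [integral_gaussianReal_eq_integral_smul one_ne_zero]
  have e : ∀ w : ℝ, gaussianPDFReal 0 1 w • expSq (w + y)
      = ((√(2 * Real.pi))⁻¹ * Real.exp (-y ^ 2 / 4)) * Real.exp (-1 * (w + y / 2) ^ 2) := by
    intro w
    simp only [gaussianPDFReal, expSq, smul_eq_mul, NNReal.coe_one, mul_one, sub_zero]
    rw [mul_assoc, mul_assoc, ← Real.exp_add, ← Real.exp_add]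
    congr 2; ring
  simp_rw [e]
  rw [integral_const_mul, integral_add_right_eq_self (fun w : ℝ => Real.exp (-1 * w ^ 2)),
    integral_gaussian, div_one, Real.sqrt_mul zero_le_two]
  have : √Real.pi ≠ 0 := (Real.sqrt_pos.2 Real.pi_pos).ne'
  field_simp

/-- Differentiate the preceding formula in `y`, using `expSq' = -testFn`. -/
theorem integral_testFn_gaussianReal (y : ℝ) :
    ∫ w, testFn (w + y) ∂(gaussianReal 0 1) = (√2)⁻¹ * (y / 2 * Real.exp (-y ^ 2 / 4)) := by
  have h1 := hasDerivAt_integral_shift (gaussianReal 0 1) hasDerivAt_expSq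
    continuous_testFn.neg abs_expSq_le (fun w => (abs_neg _).trans_le (abs_testFn_le w)) y
  simp_rw [integral_expSq_gaussianReal, integral_neg] at h1
  have h : HasDerivAt (fun w : ℝ => -w ^ 2 / 4) (-(y / 2)) y := by
    refine (((hasDerivAt_id y).pow 2).neg.div_const 4).congr_deriv ?_
    simp; ring
  have h2 := h.exp.const_mul (√2)⁻¹
  have := h1.unique h2
  linarith

theorem integral_testFnDeriv_gaussianReal :
    ∫ w, testFnDeriv w ∂(gaussianReal 0 1) = (√2)⁻¹ / 2 := by
  have h1 := hasDerivAt_integral_shift (gaussianReal 0 1) hasDerivAt_testFn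
    continuous_testFnDeriv abs_testFn_le abs_testFnDeriv_le 0
  simp_rw [integral_testFn_gaussianReal] at h1
  have h : HasDerivAt (fun w : ℝ => -w ^ 2 / 4) 0 0 := by
    refine (((hasDerivAt_id (0 : ℝ)).pow 2).neg.div_const 4).congr_deriv ?_
    simp
  have h2 := (((hasDerivAt_id (0 : ℝ)).div_const 2).mul h.exp).const_mul (√2)⁻¹
  have := h1.unique h2
  simp only [add_zero] at this
  rw [this]
  simp [div_eq_mul_inv]

theorem integral_mul_testFn_gaussianReal :
    ∫ w, w * testFn w ∂(gaussianReal 0 1) = (√2)⁻¹ / 2 := by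
  have h0 := integral_expSq_gaussianReal 0
  simp only [add_zero, ne_eq, OfNat.ofNat_ne_zero, not_false_eq_true, zero_pow, neg_zero,
    zero_div, Real.exp_zero, mul_one] at h0
  have e : ∀ w, w * testFn w = expSq w - testFnDeriv w := by
    intro w; simp only [testFn, testFnDeriv]; ring
  simp_rw [e]
  rw [integral_sub, h0, integral_testFnDeriv_gaussianReal]
  · ring
  · exact Integrable.of_bound continuous_expSq.aestronglyMeasurable 1 (ae_of_all _ abs_expSq_le)
  · exact Integrable.of_bound continuous_testFnDeriv.aestronglyMeasurable 4
      (ae_of_all _ abs_testFnDeriv_le)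

/-! ### Stein's argument for one row -/

section

variable {Ω : Type*} [MeasurableSpace Ω] {P : Measure Ω} [IsProbabilityMeasure P]

theorem integrable_comp_of_bounded {g : ℝ → ℝ} {a : ℝ} (hg : Continuous g) (ha : ∀ x, |g x| ≤ a)
    {Y : Ω → ℝ} (hY : Measurable Y) : Integrable (fun ω => g (Y ω)) P :=
  Integrable.of_bound (hg.measurable.comp hY).aestronglyMeasurable a (ae_of_all _ fun _ => ha _)

/-- If `E[f'(Y + y)]` is uniformly `ε`-close to its Gaussian counterpart, then so is the
difference quotient of `y ↦ E[f(Y + y)]` at `0`, where `f = testFn`. -/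
theorem abs_integral_testFn_add_sub_le {Y : Ω → ℝ} (hY : Measurable Y) {ε : ℝ}
    (hε : ∀ y, |∫ ω, testFnDeriv (Y ω + y) ∂P
      - ∫ w, testFnDeriv (w + y) ∂(gaussianReal 0 1)| ≤ ε) (x : ℝ) :
    |∫ ω, testFn (Y ω + x) ∂P - ∫ ω, testFn (Y ω) ∂P
      - (√2)⁻¹ * (x / 2 * Real.exp (-x ^ 2 / 4))| ≤ ε * |x| := by
  have : IsProbabilityMeasure (P.map Y) := Measure.isProbabilityMeasure_map hY.aemeasurable
  have hm : ∀ y, ∫ w, testFn (w + y) ∂(P.map Y) = ∫ ω, testFn (Y ω + y) ∂P := fun y =>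
    integral_map hY.aemeasurable (continuous_testFn.comp (by fun_prop)).aestronglyMeasurable
  have hm' : ∀ y, ∫ w, testFnDeriv (w + y) ∂(P.map Y) = ∫ ω, testFnDeriv (Y ω + y) ∂P := fun y =>
    integral_map hY.aemeasurable (continuous_testFnDeriv.comp (by fun_prop)).aestronglyMeasurable
  have hd : ∀ (μ : Measure ℝ) [IsProbabilityMeasure μ] (y : ℝ),
      HasDerivAt (fun y => ∫ w, testFn (w + y) ∂μ) (∫ w, testFnDeriv (w + y) ∂μ) y :=
    fun μ _ y => hasDerivAt_integral_shift μ hasDerivAt_testFn continuous_testFnDeriv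
      abs_testFn_le abs_testFnDeriv_le y
  -- Mean value inequality for the difference of the two smoothed functions, whose derivative is at
  -- most `ε` by `hε`.
  have key := Convex.norm_image_sub_le_of_norm_hasDerivWithin_le (s := Set.univ) (x := 0) (y := x)
    (fun y _ => ((hd (P.map Y) y).sub (hd (gaussianReal 0 1) y)).hasDerivWithinAt)
    (C := ε) (fun y _ => by simpa only [hm', Real.norm_eq_abs] using hε y)
    convex_univ trivial trivial
  simp only [Pi.sub_apply, hm, integral_testFn_gaussianReal, Real.norm_eq_abs, sub_zero, add_zero,
    zero_div, zero_mul, mul_zero] at key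
  rwa [sub_right_comm] at key

/-- By independence `Y` can be integrated out first, leaving `E[X φ(X)]`; then `φ(x) - φ(0)` is
replaced by its Gaussian value at cost `ε |x|`. -/
theorem integral_mul_testFn_add_le {X Y : Ω → ℝ} (hX : Measurable X) (hY : Measurable Y)
    (hXY : IndepFun X Y P) (hX2 : MemLp X 2 P) (hX0 : ∫ ω, X ω ∂P = 0) {ε : ℝ}
    (hε : ∀ y, |∫ ω, testFnDeriv (Y ω + y) ∂P
      - ∫ w, testFnDeriv (w + y) ∂(gaussianReal 0 1)| ≤ ε) :
    ∫ ω, X ω * testFn (X ω + Y ω) ∂P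
      ≤ (√2)⁻¹ / 2 * ∫ ω, X ω ^ 2 * Real.exp (-X ω ^ 2 / 4) ∂P + ε * ∫ ω, X ω ^ 2 ∂P := by
  have iX : Integrable X P := hX2.integrable (by norm_num)
  have iX2 : Integrable (fun ω => X ω ^ 2) P := hX2.integrable_sq
  have : IsProbabilityMeasure (P.map X) := Measure.isProbabilityMeasure_map hX.aemeasurable
  have : IsProbabilityMeasure (P.map Y) := Measure.isProbabilityMeasure_map hY.aemeasurable
  have hcont : Continuous fun p : ℝ × ℝ => p.1 * testFn (p.1 + p.2) :=
    continuous_fst.mul (continuous_testFn.comp (by fun_prop))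
  have hprod := (indepFun_iff_map_prod_eq_prod_map_map hX.aemeasurable hY.aemeasurable).1 hXY
  have iL : Integrable (fun ω => X ω * testFn (X ω + Y ω)) P :=
    iX.mul_bdd (c := 4) (continuous_testFn.measurable.comp (hX.add hY)).aestronglyMeasurable
      (ae_of_all _ fun _ => abs_testFn_le _)
  have iProd : Integrable (fun p : ℝ × ℝ => p.1 * testFn (p.1 + p.2))
      ((P.map X).prod (P.map Y)) := by
    rw [← hprod, integrable_map_measure hcont.aestronglyMeasurable (hX.prodMk hY).aemeasurable]
    exact iL
  set φ : ℝ → ℝ := fun x => ∫ ω, testFn (Y ω + x) ∂P with hφ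
  have inner : ∀ x, ∫ y, x * testFn (x + y) ∂(P.map Y) = x * φ x := by
    intro x
    rw [integral_const_mul, integral_map (f := fun y => testFn (x + y)) hY.aemeasurable
      (continuous_testFn.comp (by fun_prop)).aestronglyMeasurable]
    simp only [hφ, add_comm]
  have iφ := iProd.integral_prod_left
  simp only [inner] at iφ
  have iφX : Integrable (fun ω => X ω * φ (X ω)) P := iφ.comp_measurable hX
  have fubini : ∫ ω, X ω * testFn (X ω + Y ω) ∂P = ∫ ω, X ω * φ (X ω) ∂P := by
    rw [← integral_map (f := fun x => x * φ x) hX.aemeasurable iφ.aestronglyMeasurable,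
      ← integral_map (f := fun p : ℝ × ℝ => p.1 * testFn (p.1 + p.2))
        (hX.prodMk hY).aemeasurable hcont.aestronglyMeasurable, hprod, integral_prod _ iProd]
    simp only [inner]
  have iE : Integrable (fun ω => X ω ^ 2 * Real.exp (-X ω ^ 2 / 4)) P :=
    iX2.mul_bdd (c := 1) (by fun_prop) (ae_of_all _ fun ω => by
      rw [Real.norm_eq_abs, Real.abs_exp, Real.exp_le_one_iff]
      nlinarith [sq_nonneg (X ω)])
  -- The first term is linear in `X` and vanishes on integration, since `X` is centered.
  have bound : ∀ ω, X ω * φ (X ω) ≤ X ω * (∫ ω, testFn (Y ω) ∂P)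
      + ((√2)⁻¹ / 2 * (X ω ^ 2 * Real.exp (-X ω ^ 2 / 4)) + ε * X ω ^ 2) := by
    intro ω
    have h := abs_integral_testFn_add_sub_le hY hε (X ω)
    have h2 := mul_le_mul_of_nonneg_left h (abs_nonneg (X ω))
    rw [← abs_mul] at h2
    have h3 := (le_abs_self _).trans h2
    have h4 : |X ω| * (ε * |X ω|) = ε * X ω ^ 2 := by rw [← sq_abs (X ω)]; ring
    rw [h4] at h3
    simp only [hφ]
    linarith
  rw [fubini]
  have iR : Integrable (fun ω => (√2)⁻¹ / 2 * (X ω ^ 2 * Real.exp (-X ω ^ 2 / 4))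
      + ε * X ω ^ 2) P := (iE.const_mul _).add (iX2.const_mul ε)
  refine (integral_mono iφX ((iX.mul_const _).add iR) bound).trans_eq ?_
  rw [integral_add' (iX.mul_const _) iR, integral_mul_const, hX0, zero_mul, zero_add,
    integral_add (iE.const_mul _) (iX2.const_mul ε), integral_const_mul, integral_const_mul]

/-- The sum of the total variations of `testFnDeriv` and of `w ↦ w * testFn w`. -/
noncomputable def variationConst : ℝ :=
  (∫ y, |testFnDeriv₂ y|) + ∫ y : ℝ, |(2 * y - y ^ 3) * expSq y|

theorem variationConst_nonneg : 0 ≤ variationConst :=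
  add_nonneg (integral_nonneg fun _ => abs_nonneg _) (integral_nonneg fun _ => abs_nonneg _)

/-- Translation preserves total variation, so the bound is uniform in `y`. -/
theorem abs_integral_testFnDeriv_add_sub_le {μ ν : Measure ℝ} [IsProbabilityMeasure μ]
    [IsProbabilityMeasure ν] {δ : ℝ}
    (hδ : ∀ x, |μ.real (Set.Iic x) - ν.real (Set.Iic x)| ≤ δ) (y : ℝ) :
    |∫ w, testFnDeriv (w + y) ∂μ - ∫ w, testFnDeriv (w + y) ∂ν|
      ≤ δ * ∫ y, |testFnDeriv₂ y| := by
  refine (abs_integral_sub_integral_le_mul_variation hδ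
    (fun x => (hasDerivAt_testFnDeriv (x + y)).comp_add_const x y)
    (integrable_testFnDeriv₂.comp_add_right y)
    ((tendsto_testFnDeriv.mono_left atBot_le_cocompact).comp
      (tendsto_atBot_add_const_right _ y tendsto_id))).trans_eq ?_
  rw [integral_add_right_eq_self (fun w => |testFnDeriv₂ w|)]

theorem lipschitz_testFnDeriv (x y : ℝ) : |testFnDeriv y - testFnDeriv x| ≤ 4 * |y - x| :=
  Convex.norm_image_sub_le_of_norm_hasDerivWithin_le (s := Set.univ)
    (fun w _ => (hasDerivAt_testFnDeriv w).hasDerivWithinAt) (fun w _ => abs_testFnDeriv₂_le w)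
    convex_univ trivial trivial

theorem integral_abs_le_sqrt_integral_sq {X : Ω → ℝ} (hX : MemLp X 2 P) :
    ∫ ω, |X ω| ∂P ≤ √(∫ ω, X ω ^ 2 ∂P) := by
  refine Real.le_sqrt_of_sq_le ?_
  have h := variance_nonneg (fun ω => |X ω|) P
  have h2 : MemLp (fun ω => |X ω|) 2 P := hX.abs
  rw [variance_eq_sub h2] at h
  simp only [Pi.pow_apply, sq_abs] at h
  linarith

theorem sum_integral_sq_mul_one_sub_exp_le {ι : Type*} [Fintype ι] {ξ : ι → Ω → ℝ}
    (hm : ∀ k, Measurable (ξ k)) (h2 : ∀ k, MemLp (ξ k) 2 P) (hi : iIndepFun ξ P)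
    (h0 : ∀ k, ∫ ω, ξ k ω ∂P = 0) (h1 : ∑ k, ∫ ω, ξ k ω ^ 2 ∂P = 1) {δ M : ℝ}
    (hδ : ∀ x, |P.real {ω | ∑ k, ξ k ω ≤ x} - (gaussianReal 0 1).real (Set.Iic x)| ≤ δ)
    (hM : ∀ k, ∫ ω, ξ k ω ^ 2 ∂P ≤ M) :
    ∑ k, ∫ ω, ξ k ω ^ 2 * (1 - Real.exp (-ξ k ω ^ 2 / 4)) ∂P
      ≤ 2 * √2 * (variationConst * δ + 4 * √M) := by
  classical
  set W : Ω → ℝ := fun ω => ∑ k, ξ k ω with hW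
  have mW : Measurable W := Finset.measurable_fun_sum _ fun k _ => hm k
  have : IsProbabilityMeasure (P.map W) := Measure.isProbabilityMeasure_map mW.aemeasurable
  have hδ' : ∀ x, |(P.map W).real (Set.Iic x) - (gaussianReal 0 1).real (Set.Iic x)| ≤ δ := by
    intro x
    rw [map_measureReal_apply mW measurableSet_Iic]
    exact hδ x
  set V₁ := ∫ y, |testFnDeriv₂ y| with hV₁
  have iX : ∀ k, Integrable (ξ k) P := fun k => (h2 k).integrable (by norm_num)
  -- `δ * V₁` is the cost of replacing `W` by a Gaussian, `4 * √M` that of deleting `ξ k` from `W`.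
  have ε_bound : ∀ k y, |∫ ω, testFnDeriv ((W ω - ξ k ω) + y) ∂P
      - ∫ w, testFnDeriv (w + y) ∂(gaussianReal 0 1)| ≤ δ * V₁ + 4 * √M := by
    intro k y
    have e1 := abs_integral_testFnDeriv_add_sub_le hδ' y
    rw [integral_map (f := fun w => testFnDeriv (w + y)) mW.aemeasurable
      (continuous_testFnDeriv.comp (by fun_prop)).aestronglyMeasurable] at e1
    have i1 : Integrable (fun ω => testFnDeriv ((W ω - ξ k ω) + y)) P :=
      integrable_comp_of_bounded continuous_testFnDeriv abs_testFnDeriv_le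
        ((mW.sub (hm k)).add_const y)
    have i2 : Integrable (fun ω => testFnDeriv (W ω + y)) P :=
      integrable_comp_of_bounded continuous_testFnDeriv abs_testFnDeriv_le (mW.add_const y)
    have e2 : |∫ ω, testFnDeriv ((W ω - ξ k ω) + y) ∂P - ∫ ω, testFnDeriv (W ω + y) ∂P|
        ≤ 4 * √M := by
      rw [← integral_sub i1 i2]
      refine abs_integral_le_integral_abs.trans ?_
      calc ∫ ω, |testFnDeriv ((W ω - ξ k ω) + y) - testFnDeriv (W ω + y)| ∂P
          ≤ ∫ ω, 4 * |ξ k ω| ∂P := by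
            refine integral_mono (i1.sub i2).abs ((iX k).abs.const_mul 4) fun ω => ?_
            refine (lipschitz_testFnDeriv _ _).trans_eq ?_
            rw [show W ω - ξ k ω + y - (W ω + y) = -ξ k ω by ring, abs_neg]
        _ ≤ 4 * √M := by
            rw [integral_const_mul]
            gcongr
            exact (integral_abs_le_sqrt_integral_sq (h2 k)).trans (Real.sqrt_le_sqrt (hM k))
    have := abs_sub_le (∫ ω, testFnDeriv ((W ω - ξ k ω) + y) ∂P)
      (∫ ω, testFnDeriv (W ω + y) ∂P) (∫ w, testFnDeriv (w + y) ∂(gaussianReal 0 1))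
    linarith
  have indep : ∀ k, IndepFun (ξ k) (fun ω => W ω - ξ k ω) P := by
    intro k
    have h := (hi.indepFun_finsetSum_of_notMem hm (Finset.notMem_erase k Finset.univ)).symm
    convert h using 1
    ext ω
    rw [Finset.sum_apply, hW, Finset.sum_erase_eq_sub (Finset.mem_univ k)]
  have upper : ∀ k, ∫ ω, ξ k ω * testFn (W ω) ∂P
      ≤ (√2)⁻¹ / 2 * ∫ ω, ξ k ω ^ 2 * Real.exp (-ξ k ω ^ 2 / 4) ∂P
        + (δ * V₁ + 4 * √M) * ∫ ω, ξ k ω ^ 2 ∂P := by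
    intro k
    have h := integral_mul_testFn_add_le (hm k) (mW.sub (hm k)) (indep k) (h2 k) (h0 k)
      (ε_bound k)
    simpa only [Pi.sub_apply, add_sub_cancel] using h
  have lower : (√2)⁻¹ / 2 - δ * ∫ y : ℝ, |(2 * y - y ^ 3) * expSq y|
      ≤ ∑ k, ∫ ω, ξ k ω * testFn (W ω) ∂P := by
    have h := abs_integral_sub_integral_le_mul_variation hδ' hasDerivAt_mul_testFn
      integrable_deriv_mul_testFn (tendsto_mul_testFn.mono_left atBot_le_cocompact)
    rw [integral_map (f := fun w => w * testFn w) mW.aemeasurable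
      (continuous_id.mul continuous_testFn).aestronglyMeasurable,
      integral_mul_testFn_gaussianReal] at h
    rw [← integral_finsetSum]
    · simp_rw [← Finset.sum_mul]
      have := (abs_le.1 h).1
      linarith
    · intro k _
      exact (iX k).mul_bdd (c := 4) (continuous_testFn.measurable.comp mW).aestronglyMeasurable
        (ae_of_all _ fun _ => abs_testFn_le _)
  have total := lower.trans (Finset.sum_le_sum fun k _ => upper k)
  rw [Finset.sum_add_distrib, ← Finset.mul_sum, ← Finset.mul_sum, h1, mul_one] at total
  have iE : ∀ k, Integrable (fun ω => ξ k ω ^ 2 * Real.exp (-ξ k ω ^ 2 / 4)) P := fun k =>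
    (h2 k).integrable_sq.mul_bdd (c := 1) (by have := hm k; fun_prop) (ae_of_all _ fun ω => by
      rw [Real.norm_eq_abs, Real.abs_exp, Real.exp_le_one_iff]
      nlinarith [sq_nonneg (ξ k ω)])
  have split : ∑ k, ∫ ω, ξ k ω ^ 2 * (1 - Real.exp (-ξ k ω ^ 2 / 4)) ∂P
      = 1 - ∑ k, ∫ ω, ξ k ω ^ 2 * Real.exp (-ξ k ω ^ 2 / 4) ∂P := by
    simp_rw [mul_sub, mul_one]
    rw [Finset.sum_congr rfl fun k _ => integral_sub (h2 k).integrable_sq (iE k),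
      Finset.sum_sub_distrib, h1]
  rw [split]
  set S := ∑ k, ∫ ω, ξ k ω ^ 2 * Real.exp (-ξ k ω ^ 2 / 4) ∂P
  have hs : 2 * √2 * ((√2)⁻¹ / 2) = 1 := by
    have : √2 ≠ 0 := by positivity
    field_simp
  have h3 : (√2)⁻¹ / 2 * (1 - S) ≤ variationConst * δ + 4 * √M := by
    unfold variationConst
    linarith
  calc 1 - S = 2 * √2 * ((√2)⁻¹ / 2 * (1 - S)) := by rw [← mul_assoc, hs, one_mul]
    _ ≤ _ := by gcongr

end

/-! ### Change of exponent and passage to the limit -/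

/-- For `4γ ≤ 1` monotonicity suffices; otherwise this is Bernoulli's inequality for the power `4γ`
of `exp(-t/4)`. -/
theorem one_sub_exp_neg_mul_le (γ : ℝ) {t : ℝ} (ht : 0 ≤ t) :
    1 - Real.exp (-γ * t) ≤ max 1 (4 * γ) * (1 - Real.exp (-t / 4)) := by
  have h0 : Real.exp (-t / 4) ≤ 1 := Real.exp_le_one_iff.2 (by linarith)
  rcases le_total (4 * γ) 1 with h | h
  · rw [max_eq_left h, one_mul]
    have : Real.exp (-t / 4) ≤ Real.exp (-γ * t) := Real.exp_le_exp.2 (by nlinarith)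
    linarith
  · rw [max_eq_right h]
    have hb := one_add_mul_self_le_rpow_one_add (s := Real.exp (-t / 4) - 1)
      (by linarith [Real.exp_pos (-t / 4)]) h
    rw [add_sub_cancel, ← Real.exp_mul, show -t / 4 * (4 * γ) = -γ * t by ring] at hb
    linarith

theorem abs_measureReal_sub_le_one {Ω Ω' : Type*} [MeasurableSpace Ω] [MeasurableSpace Ω']
    (P : Measure Ω) (P' : Measure Ω') [IsProbabilityMeasure P] [IsProbabilityMeasure P']
    (s : Set Ω) (t : Set Ω') : |P.real s - P'.real t| ≤ 1 := by
  have h1 : P.real s ≤ 1 := measureReal_le_one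
  have h2 : P'.real t ≤ 1 := measureReal_le_one
  have h3 : 0 ≤ P.real s := measureReal_nonneg
  have h4 : 0 ≤ P'.real t := measureReal_nonneg
  rw [abs_le]
  constructor <;> linarith

theorem abs_measureReal_sub_le_kolmogorovDist {Ω Ω' : Type*} [MeasurableSpace Ω]
    [MeasurableSpace Ω'] (P : Measure Ω) (P' : Measure Ω') [IsProbabilityMeasure P]
    [IsProbabilityMeasure P'] (η : Ω → ℝ) (η' : Ω' → ℝ) (x : ℝ) :
    |P.real {ω | η ω ≤ x} - P'.real {ω | η' ω ≤ x}| ≤ kolmogorovDist P P' η η' :=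
  le_ciSup (f := fun x : ℝ => |P.real {ω | η ω ≤ x} - P'.real {ω | η' ω ≤ x}|)
    ⟨1, by rintro _ ⟨y, rfl⟩; exact abs_measureReal_sub_le_one P P' _ _⟩ x

theorem kolmogorovDist_le_one {Ω Ω' : Type*} [MeasurableSpace Ω] [MeasurableSpace Ω']
    (P : Measure Ω) (P' : Measure Ω') [IsProbabilityMeasure P] [IsProbabilityMeasure P']
    (η : Ω → ℝ) (η' : Ω' → ℝ) : kolmogorovDist P P' η η' ≤ 1 :=
  ciSup_le fun _ => abs_measureReal_sub_le_one P P' _ _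

theorem kolmogorovDist_nonneg {Ω Ω' : Type*} [MeasurableSpace Ω] [MeasurableSpace Ω']
    (P : Measure Ω) (P' : Measure Ω') (η : Ω → ℝ) (η' : Ω' → ℝ) :
    0 ≤ kolmogorovDist P P' η η' :=
  Real.iSup_nonneg fun _ => abs_nonneg _

theorem limsup_le_mul_limsup {a κ e : ℕ → ℝ} {C : ℝ} (hC : 0 < C) (ha : ∀ n, 0 ≤ a n)
    (hκ : ∀ n, κ n ≤ 1) (h : ∀ᶠ n in atTop, a n ≤ C * κ n + e n) (he : Tendsto e atTop (𝓝 0)) :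
    limsup a atTop ≤ C * limsup κ atTop := by
  refine le_of_forall_pos_le_add fun ε hε => ?_
  have hb : IsBoundedUnder (· ≤ ·) atTop κ := isBoundedUnder_of ⟨1, hκ⟩
  have h1 := eventually_lt_of_limsup_lt
    (show limsup κ atTop < limsup κ atTop + ε / (2 * C) by
      have : 0 < ε / (2 * C) := by positivity
      linarith) hb
  have ba : IsBoundedUnder (· ≥ ·) atTop a := isBoundedUnder_of ⟨0, ha⟩
  refine limsup_le_of_le ba.isCoboundedUnder_le ?_
  filter_upwards [h, h1, he.eventually_lt_const (half_pos hε)] with n h2 h3 h4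
  have h5 : C * κ n ≤ C * (limsup κ atTop + ε / (2 * C)) := by gcongr
  have h6 : C * (limsup κ atTop + ε / (2 * C)) = C * limsup κ atTop + ε / 2 := by
    field_simp
  linarith

theorem corollary3p5 (γ : ℝ) (hγ : 0 < γ) :
    ∃ C : ℝ, 0 < C ∧
      ∀ (Ω : ℕ → Type*) [∀ n, MeasurableSpace (Ω n)]
        (P : ∀ n, Measure (Ω n)) [∀ n, IsProbabilityMeasure (P n)]
        (ξ : ∀ n, Fin n → Ω n → ℝ)
        (Ω' : Type*) [MeasurableSpace Ω'] (P' : Measure Ω') [IsProbabilityMeasure P']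
        (Z : Ω' → ℝ),
        IsStandardTriangularArray P ξ → FellerNegligible P ξ →
        HasLaw Z (gaussianReal 0 1) P' →
        relaxedLindebergIndex P ξ (lindebergPhi γ) ≤
          C * limsup (fun n => kolmogorovDist P' (P n) Z (fun ω => ∑ k, ξ n k ω)) atTop := by
  set c : ℝ := max 1 (4 * γ) with hc
  have c_pos : 0 < c := zero_lt_one.trans_le (le_max_left _ _)
  have V := variationConst_nonneg
  -- The `+ 1` makes positivity of the constant immediate from `0 ≤ variationConst`.
  refine ⟨c * (2 * √2 * (variationConst + 1)), by positivity, ?_⟩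
  intro Ω _ P _ ξ Ω' _ P' _ Z hξ hF hZ
  set M : ℕ → ℝ := fun n => ⨆ k : Fin n, ∫ ω, (ξ n k ω) ^ 2 ∂(P n) with hMdef
  have hφ : ∀ x, 0 ≤ lindebergPhi γ x := fun x => by
    unfold lindebergPhi
    have : Real.exp (-γ * x ^ 2) ≤ 1 := Real.exp_le_one_iff.2 (by nlinarith [sq_nonneg x])
    linarith
  refine limsup_le_mul_limsup (e := fun n => c * (2 * √2 * (4 * √(M n)))) (by positivity)
    (fun n => Finset.sum_nonneg fun k _ => integral_nonneg fun ω =>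
      mul_nonneg (sq_nonneg _) (hφ _))
    (fun n => kolmogorovDist_le_one _ _ _ _) ?_ ?_
  · filter_upwards [eventually_ge_atTop 1] with n hn
    set κ := kolmogorovDist P' (P n) Z (fun ω => ∑ k, ξ n k ω) with hκ
    have hδ : ∀ x, |(P n).real {ω | ∑ k, ξ n k ω ≤ x} - (gaussianReal 0 1).real (Set.Iic x)|
        ≤ κ := by
      intro x
      rw [← hZ.map_eq, map_measureReal_apply_of_aemeasurable hZ.aemeasurable measurableSet_Iic,
        abs_sub_comm]
      exact abs_measureReal_sub_le_kolmogorovDist P' (P n) Z (fun ω => ∑ k, ξ n k ω) x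
    have hM : ∀ k, ∫ ω, ξ n k ω ^ 2 ∂(P n) ≤ M n := fun k =>
      le_ciSup (f := fun k => ∫ ω, ξ n k ω ^ 2 ∂(P n)) (Set.finite_range _).bddAbove k
    have row := sum_integral_sq_mul_one_sub_exp_le (hξ.measurable n hn) (hξ.memLp n hn)
      (hξ.indep n hn) (hξ.integral_eq_zero n hn) (hξ.sum_variance n hn) hδ hM
    have compare : ∑ k, ∫ ω, ξ n k ω ^ 2 * lindebergPhi γ |ξ n k ω| ∂(P n)
        ≤ c * ∑ k, ∫ ω, ξ n k ω ^ 2 * (1 - Real.exp (-ξ n k ω ^ 2 / 4)) ∂(P n) := by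
      rw [Finset.mul_sum]
      refine Finset.sum_le_sum fun k _ => ?_
      rw [← integral_const_mul]
      have := hξ.measurable n hn k
      refine integral_mono_of_nonneg (ae_of_all _ fun ω => mul_nonneg (sq_nonneg _) (hφ _))
        (((hξ.memLp n hn k).integrable_sq.mul_bdd (c := 1) (by fun_prop)
          (ae_of_all _ fun ω => ?_)).const_mul c) (ae_of_all _ fun ω => ?_)
      · have h1 := Real.exp_pos (-ξ n k ω ^ 2 / 4)
        have h2 : Real.exp (-ξ n k ω ^ 2 / 4) ≤ 1 :=
          Real.exp_le_one_iff.2 (by nlinarith [sq_nonneg (ξ n k ω)])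
        rw [Real.norm_eq_abs, abs_le]
        constructor <;> linarith
      · have h := mul_le_mul_of_nonneg_left (one_sub_exp_neg_mul_le γ (sq_nonneg (ξ n k ω)))
          (sq_nonneg (ξ n k ω))
        simp only [lindebergPhi, sq_abs]
        linarith
    refine compare.trans ((mul_le_mul_of_nonneg_left row c_pos.le).trans ?_)
    have κ0 : 0 ≤ κ := kolmogorovDist_nonneg _ _ _ _
    calc c * (2 * √2 * (variationConst * κ + 4 * √(M n)))
        ≤ c * (2 * √2 * ((variationConst + 1) * κ + 4 * √(M n))) := by gcongr; linarith
      _ = c * (2 * √2 * (variationConst + 1)) * κ + c * (2 * √2 * (4 * √(M n))) := by ring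
  · have hF' : Tendsto M atTop (𝓝 0) := hF
    have h := ((((Real.continuous_sqrt.tendsto 0).comp hF').const_mul 4).const_mul
      (2 * √2)).const_mul c
    simpa using h
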